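/- Let $v\ge 2$ be an integer and let $\mathcal A_v$ be the real Cayley--Dickson algebra of dimension $2^v$ (so $\mathcal A_0=\mathbb R$ and $\mathcal A_{v+1}=\mathcal A_v\oplus\mathcal A_v l$ with $(a+bl)(c+dl)=(ac-d^*b)+(da+bc^*)l$, $(a+bl)^*=a^*-bl$), with Euclidean norm $|z|=(zz^*)^{1/2}$ and $z^{-1}=|z|^{-2}z^*$ for $z\neq 0$. Put $\mathcal A_v^\bullet=\mathcal A_v\setminus\{0\}$ and $B=\{z\in\mathcal A_v^\bullet: |z|\le 1\}$. A subgroup of $\mathcal A_v^\bullet$ (associativity is not required) is a set $G\subset\mathcal A_v^\bullet$ that contains $1$, contains $g^{-1}$ for every $g\in G$, and contains $gh$ for all $g,h\in G$ with $gh\ne 0$; the case $gh=0$ is not excluded (it can occur only for $v\ge 4$). For $A\subset G$ and $g\in G$ put $Ag=\{hg: h\in A,\ hg\ne 0\}\subset G$. A (nonnegative, $\sigma$-additive) measure $\mu$ on the Borel $\sigma$-algebra $\mathcal B(G)$ is called right-invariant if for all $g\in G$ and $A\in\mathcal B(G)$ the set $Ag$ is Borel and $\mu(Ag)=\mu(\{h\in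 A: hg\neq 0\})$; when $G$ has no zero products, in particular when $v\le 3$, this says $\mu(Ag)=\mu(A)$. Theorem. Let $G$ be a subgroup of $\mathcal A_v^\bullet$ that is contained in $B$ and is locally connected in the subspace topology. Then there exists a nonzero, nonnegative, right-invariant, $\sigma$-additive measure $\mu$ on $\mathcal B(G)$. If moreover $G$ is closed, then $\mu$ can be taken to be the push-forward $\mu(A)=\nu(f^{-1}(A))$ of the measure $\nu(dz)=|z|^{-1}\lambda(dz)$ on $B$, where $\lambda$ is Lebesgue measure on $\mathcal A_v\cong\mathbb R^{2^v}$, under a Borel retraction $f:B\to G$, that is, a Borel map with $f(z)=z$ for all $z\in G$ (so that $f(B)=G$). -/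

import Mathlib

open MeasureTheory

/-- Index set of the standard real basis of the `v`-th Cayley–Dickson algebra (`2 ^ v` elements);
`Sum.inl i` is the generator `i` of the previous algebra, `Sum.inr i` is `i` times the doubling
generator. -/
def CDIndex : ℕ → Type
  | 0 => Unit
  | v + 1 => CDIndex v ⊕ CDIndex v

instance CDIndex.instFintype : ∀ v : ℕ, Fintype (CDIndex v)
  | 0 => inferInstanceAs (Fintype Unit)
  | v + 1 =>
    letI := CDIndex.instFintype v
    inferInstanceAs (Fintype (CDIndex v ⊕ CDIndex v))

/-- The underlying Euclidean space `ℝ ^ (2 ^ v)` of the Cayley–Dickson algebra `𝒜_v`; it carries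
the Euclidean norm `|z|`, its Borel sets, and Lebesgue measure `volume`. -/
abbrev CayleyDickson (v : ℕ) : Type := EuclideanSpace ℝ (CDIndex v)

namespace CayleyDickson

/-- The unit in coordinates. -/
def oneFun : ∀ v : ℕ, CDIndex v → ℝ
  | 0 => fun _ => 1
  | v + 1 => Sum.elim (oneFun v) (fun _ => 0)

/-- Conjugation in coordinates: `(a + b l)* = a* - b l`. -/
def conjFun : ∀ v : ℕ, (CDIndex v → ℝ) → CDIndex v → ℝ
  | 0 => fun a => a
  | v + 1 => fun a => Sum.elim (conjFun v (fun i => a (Sum.inl i))) (fun i => -a (Sum.inr i))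

/-- Multiplication in coordinates, by the doubling rule
`(a + b l) (c + d l) = (a c - d* b) + (d a + b c*) l`. -/
def mulFun : ∀ v : ℕ, (CDIndex v → ℝ) → (CDIndex v → ℝ) → CDIndex v → ℝ
  | 0 => fun a b i => a i * b i
  | v + 1 => fun x y =>
    let a : CDIndex v → ℝ := fun i => x (Sum.inl i)
    let b : CDIndex v → ℝ := fun i => x (Sum.inr i)
    let c : CDIndex v → ℝ := fun i => y (Sum.inl i)
    let d : CDIndex v → ℝ := fun i => y (Sum.inr i)
    Sum.elim (fun i => mulFun v a c i - mulFun v (conjFun v d) b i)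
      (fun i => mulFun v d a i + mulFun v b (conjFun v c) i)

variable {v : ℕ}

/-- The unit element `1` of `𝒜_v`. -/
noncomputable def one (v : ℕ) : CayleyDickson v := WithLp.toLp 2 (oneFun v)

/-- The conjugate `z*`. -/
noncomputable def conj (z : CayleyDickson v) : CayleyDickson v := WithLp.toLp 2 (conjFun v z.ofLp)

/-- The product `z w` of `𝒜_v`. -/
noncomputable def mul (z w : CayleyDickson v) : CayleyDickson v :=
  WithLp.toLp 2 (mulFun v z.ofLp w.ofLp)

/-- The inverse `z⁻¹ = |z|⁻² z*` (for `z ≠ 0`). -/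
noncomputable def inv (z : CayleyDickson v) : CayleyDickson v := (‖z‖ ^ 2)⁻¹ • conj z

/-- `G` is a (not necessarily associative) subgroup of the multiplicative group `𝒜_v \ {0}`:
it contains `1`, is closed under inverses, and contains every product `g h` of its elements,
except that `g h = 0` is not excluded (this can only happen for `v ≥ 4`). -/
structure IsSubgroup (G : Set (CayleyDickson v)) : Prop where
  zero_notMem : (0 : CayleyDickson v) ∉ G
  one_mem : one v ∈ G
  inv_mem : ∀ g ∈ G, inv g ∈ G
  mul_mem : ∀ g ∈ G, ∀ h ∈ G, mul g h ≠ 0 → mul g h ∈ G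

/-- The unit ball of `𝒜_v \ {0}` with centre `0`. -/
def unitBall (v : ℕ) : Set (CayleyDickson v) := {z | z ≠ 0 ∧ ‖z‖ ≤ 1}

/-- The right translate `A g` of `A ⊆ G`, as a subset of `G` (zero products are discarded). -/
def rightTranslate {G : Set (CayleyDickson v)} (A : Set G) (g : G) : Set G :=
  {k | ∃ h ∈ A, (k : CayleyDickson v) = mul (h : CayleyDickson v) (g : CayleyDickson v)}

/-- Right invariance of a Borel measure on `G`: the translate `A g` is Borel and `μ (A g) = μ A`,
where the elements `h` of `A` with `h g = 0`, which have no translate in `G`, are discarded.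
If `G` has no zero products (always so for `v ≤ 3`), this is `μ (A g) = μ A` for all `A`, `g`. -/
def IsRightInvariant {G : Set (CayleyDickson v)} (μ : Measure G) : Prop :=
  ∀ (g : G) (A : Set G), MeasurableSet A →
    MeasurableSet (rightTranslate A g) ∧
      μ (rightTranslate A g) =
        μ {h | h ∈ A ∧ mul (h : CayleyDickson v) (g : CayleyDickson v) ≠ 0}

/-- The measure `|z|⁻¹ λ(dz)` on the unit ball, `λ` being Lebesgue measure. -/
noncomputable def ballMeasure (v : ℕ) : Measure (unitBall v) :=
  ((volume : Measure (CayleyDickson v)).withDensity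
    (fun z => ENNReal.ofReal ‖z‖⁻¹)).comap Subtype.val

end CayleyDickson

/-! Elements of `G` and their inverses have norm at most 1, so `G` lies on the unit sphere and
inversion is conjugation. Multiplication by `g` has multiplication by the conjugate of `g` as its
adjoint (`dotFun_mulFun`). Hence, if `x g ≠ 0`, the unit vectors `(x g) g*` and `x` have inner
product `|x g|² = 1` and coincide (`IsSubgroup.mul_mul_conj`). So right translation by `g` is an
isometry between two open subsets of `G`, with inverse the translation by `g*`, although neither
associativity nor alternativity is available.

A nonempty compact metric space has a Borel probability measure invariant under all isometries
between open subsets (`exists_isProbabilityMeasure_image_eq`): take an ultrafilter limit of relative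
packing numbers, as in the construction of Haar measure. This settles closed `G`. In general it
applies to the closure, which is again a subgroup; its measure is restricted to `G`, and counting
measure serves if the trace is zero.

For the push-forward, a power of the radius is uniform on `[0,1]` under the normalized ball measure,
and every probability measure on the standard Borel space `G` is an image of the uniform one. Since
the sphere is null, the map can be redefined as the identity on `G` (`exists_retraction_map_eq`). -/

open Filter Topology TopologicalSpace Metric
open scoped NNReal ENNReal

/-! ### Packing numbers -/

section Packing

variable {X : Type*} [PseudoEMetricSpace X] {ε : ℝ≥0} {A B : Set X}

theorem packingNumber_mono_set (h : A ⊆ B) : packingNumber ε A ≤ packingNumber ε B := by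
  refine iSup₂_le fun C hC => iSup_le fun hs => ?_
  exact hs.encard_le_packingNumber (hC.trans h)

theorem packingNumber_union_le (A B : Set X) :
    packingNumber ε (A ∪ B) ≤ packingNumber ε A + packingNumber ε B := by
  refine iSup₂_le fun C hC => iSup_le fun hs => ?_
  have hCeq : C = (C ∩ A) ∪ (C ∩ B) := by
    rw [← Set.inter_union_distrib_left, Set.inter_eq_left.2 hC]
  calc C.encard = ((C ∩ A) ∪ (C ∩ B)).encard := by rw [← hCeq]
    _ ≤ (C ∩ A).encard + (C ∩ B).encard := Set.encard_union_le _ _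
    _ ≤ _ := add_le_add
      ((hs.subset Set.inter_subset_left).encard_le_packingNumber Set.inter_subset_right)
      ((hs.subset Set.inter_subset_left).encard_le_packingNumber Set.inter_subset_right)

/-- Packing numbers are superadditive on sets that are more than `ε` apart. -/
theorem packingNumber_add_le_of_lt_edist (h : ∀ a ∈ A, ∀ b ∈ B, (ε : ℝ≥0∞) < edist a b) :
    packingNumber ε A + packingNumber ε B ≤ packingNumber ε (A ∪ B) := by
  have key : ∀ S : Set X, packingNumber ε S =
      ⨆ (C : Set X) (_ : C ⊆ S ∧ IsSeparated ε C), C.encard := fun S => by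
    simp only [packingNumber, iSup_and]
  rw [key A, key B]
  refine ENat.biSup_add_biSup_le' ⟨∅, by simp⟩ ⟨∅, by simp⟩ ?_
  rintro C ⟨hCA, hC⟩ D ⟨hDB, hD⟩
  have hdisj : Disjoint C D := by
    refine Set.disjoint_left.2 fun x hxC hxD => ?_
    simpa using h x (hCA hxC) x (hDB hxD)
  rw [← Set.encard_union_eq hdisj]
  refine IsSeparated.encard_le_packingNumber (Set.union_subset_union hCA hDB) ?_
  rintro x (hx | hx) y (hy | hy) hxy
  · exact hC hx hy hxy
  · exact h x (hCA hx) y (hDB hy)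
  · rw [edist_comm]
    exact h y (hCA hy) x (hDB hx)
  · exact hD hx hy hxy

theorem packingNumber_le_packingNumber_image {Y : Type*} [PseudoEMetricSpace Y] {f : X → Y}
    (hf : ∀ x ∈ A, ∀ y ∈ A, edist (f x) (f y) = edist x y) :
    packingNumber ε A ≤ packingNumber ε (f '' A) := by
  refine iSup₂_le fun C hC => iSup_le fun hs => ?_
  have hinj : Set.InjOn f C := by
    intro x hx y hy hxy
    by_contra hne
    have : (ε : ℝ≥0∞) < edist x y := hs hx hy hne
    rw [← hf x (hC hx) y (hC hy), hxy] at this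
    simp at this
  rw [← hinj.encard_image]
  refine IsSeparated.encard_le_packingNumber (Set.image_mono hC) ?_
  rintro _ ⟨x, hx, rfl⟩ _ ⟨y, hy, rfl⟩ hxy
  rw [hf x (hC hx) y (hC hy)]
  exact hs hx hy fun h => hxy (h ▸ rfl)

/-- A ball of radius `ε / 2` contains at most one point of an `ε`-separated set, so a finite `ε /
2`-net bounds the packing number. -/
theorem packingNumber_ne_top_of_totallyBounded (hε : ε ≠ 0) (hA : TotallyBounded A) :
    packingNumber ε A ≠ ⊤ := by
  have hε2 : ε / 2 ≠ 0 := by positivity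
  obtain ⟨N, -, hN, hcov⟩ := exists_finite_isCover_of_totallyBounded hε2 hA
  have h1 := packingNumber_two_mul_le_externalCoveringNumber (ε / 2) A
  rw [mul_div_cancel₀ ε two_ne_zero] at h1
  exact ((h1.trans hcov.externalCoveringNumber_le_encard).trans_lt
    (Set.encard_lt_top_iff.2 hN)).ne

end Packing

/-! ### A measure invariant under partial isometries of a compact metric space -/

section PackingContent

variable {X : Type*} [MetricSpace X]

/-- A partial bijection between open sets that preserves distances. -/
structure IsPartialIsometry (e : PartialEquiv X X) : Prop where
  isOpen_source : IsOpen e.source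
  isOpen_target : IsOpen e.target
  edist_eq : ∀ x ∈ e.source, ∀ y ∈ e.source, edist (e x) (e y) = edist x y

theorem IsPartialIsometry.symm {e : PartialEquiv X X} (he : IsPartialIsometry e) :
    IsPartialIsometry e.symm where
  isOpen_source := he.isOpen_target
  isOpen_target := he.isOpen_source
  edist_eq x hx y hy := by
    rw [← he.edist_eq _ (e.map_target hx) _ (e.map_target hy), e.right_inv hx, e.right_inv hy]

theorem IsPartialIsometry.continuousOn {e : PartialEquiv X X} (he : IsPartialIsometry e) :
    ContinuousOn e e.source := by
  rw [continuousOn_iff_continuous_domRestrict]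
  exact Isometry.continuous fun x y => he.edist_eq x x.2 y y.2

/-- The packing number at scale `1 / (n + 1)` relative to that of the whole space. -/
noncomputable def packingRatio (n : ℕ) (A : Set X) : ℝ≥0 :=
  ((packingNumber ((n + 1 : ℝ≥0)⁻¹) A).toNat : ℝ≥0) /
    ((packingNumber ((n + 1 : ℝ≥0)⁻¹) (Set.univ : Set X)).toNat : ℝ≥0)

variable [CompactSpace X]

theorem packingNumber_ne_top {ε : ℝ≥0} (hε : ε ≠ 0) (A : Set X) : packingNumber ε A ≠ ⊤ :=
  packingNumber_ne_top_of_totallyBounded hε (isCompact_univ.totallyBounded.subset A.subset_univ)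

theorem packingRatio_mono (n : ℕ) {A B : Set X} (h : A ⊆ B) :
    packingRatio n A ≤ packingRatio n B := by
  unfold packingRatio
  gcongr
  · exact packingNumber_ne_top (inv_ne_zero n.cast_add_one_ne_zero) _
  · exact packingNumber_mono_set h

theorem packingRatio_univ [Nonempty X] (n : ℕ) : packingRatio n (Set.univ : Set X) = 1 := by
  refine div_self ?_
  rw [Nat.cast_ne_zero, Ne, ENat.toNat_eq_zero, not_or]
  exact ⟨(packingNumber_pos_iff.2 Set.univ_nonempty).ne',
    packingNumber_ne_top (inv_ne_zero n.cast_add_one_ne_zero) _⟩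

theorem packingRatio_le_one (n : ℕ) (A : Set X) : packingRatio n A ≤ 1 :=
  (packingRatio_mono n A.subset_univ).trans (div_self_le_one _)

theorem packingRatio_union_le (n : ℕ) (A B : Set X) :
    packingRatio n (A ∪ B) ≤ packingRatio n A + packingRatio n B := by
  have hε : ((n + 1 : ℝ≥0)⁻¹) ≠ 0 := inv_ne_zero n.cast_add_one_ne_zero
  unfold packingRatio
  rw [← add_div]
  gcongr
  rw [← Nat.cast_add, ← ENat.toNat_add (packingNumber_ne_top hε _) (packingNumber_ne_top hε _)]
  exact_mod_cast ENat.toNat_le_toNat (packingNumber_union_le A B)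
    (by simp [packingNumber_ne_top hε])

theorem packingRatio_add_le {n : ℕ} {A B : Set X}
    (h : ∀ a ∈ A, ∀ b ∈ B, (((n + 1 : ℝ≥0)⁻¹ : ℝ≥0) : ℝ≥0∞) < edist a b) :
    packingRatio n A + packingRatio n B ≤ packingRatio n (A ∪ B) := by
  have hε : ((n + 1 : ℝ≥0)⁻¹) ≠ 0 := inv_ne_zero n.cast_add_one_ne_zero
  unfold packingRatio
  rw [← add_div]
  gcongr
  rw [← Nat.cast_add, ← ENat.toNat_add (packingNumber_ne_top hε _) (packingNumber_ne_top hε _)]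
  exact_mod_cast ENat.toNat_le_toNat (packingNumber_add_le_of_lt_edist h)
    (packingNumber_ne_top hε _)

theorem packingRatio_le_packingRatio_image (n : ℕ) {A : Set X} {f : X → X}
    (hf : ∀ x ∈ A, ∀ y ∈ A, edist (f x) (f y) = edist x y) :
    packingRatio n A ≤ packingRatio n (f '' A) := by
  unfold packingRatio
  gcongr
  · exact packingNumber_ne_top (inv_ne_zero n.cast_add_one_ne_zero) _
  · exact packingNumber_le_packingNumber_image hf

theorem exists_tendsto_packingRatio (A : Set X) :
    ∃ l, Tendsto (fun n => packingRatio n A) (hyperfilter ℕ : Filter ℕ) (𝓝 l) := by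
  obtain ⟨l, -, hl⟩ := (isCompact_Icc (a := (0 : ℝ≥0)) (b := 1)).ultrafilter_le_nhds
    ((hyperfilter ℕ).map fun n => packingRatio n A)
    (le_principal_iff.2 (Filter.mem_map.2
      (Filter.univ_mem' fun n => ⟨zero_le, packingRatio_le_one n A⟩)))
  exact ⟨l, hl⟩

/-- The limit of the relative packing numbers along a fixed nonprincipal ultrafilter. -/
noncomputable def packingLimit (A : Set X) : ℝ≥0 := (exists_tendsto_packingRatio A).choose

theorem tendsto_packingLimit (A : Set X) :
    Tendsto (fun n => packingRatio n A) (hyperfilter ℕ : Filter ℕ) (𝓝 (packingLimit A)) :=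
  (exists_tendsto_packingRatio A).choose_spec

variable (X) in
/-- The content on a compact metric space defined by relative packing numbers. -/
noncomputable def packingContent : Content X where
  toFun K := packingLimit (K : Set X)
  mono' K₁ K₂ h := le_of_tendsto_of_tendsto' (tendsto_packingLimit _) (tendsto_packingLimit _)
    fun n => packingRatio_mono n h
  sup_le' K₁ K₂ := le_of_tendsto_of_tendsto' (tendsto_packingLimit _)
    ((tendsto_packingLimit _).add (tendsto_packingLimit _))
    fun n => packingRatio_union_le n _ _
  sup_disjoint' K₁ K₂ h _ h₂ := by
    refine le_antisymm (le_of_tendsto_of_tendsto' (tendsto_packingLimit _)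
      ((tendsto_packingLimit _).add (tendsto_packingLimit _))
      fun n => packingRatio_union_le n _ _) ?_
    refine le_of_tendsto_of_tendsto
      ((tendsto_packingLimit _).add (tendsto_packingLimit _)) (tendsto_packingLimit _) ?_
    -- Disjoint compact sets are a positive distance `r` apart. Once the scale is below `r`, packing
    -- numbers are superadditive on them; a nonprincipal ultrafilter sees only such scales.
    obtain ⟨r, hr, hrd⟩ := exists_pos_forall_lt_edist K₁.isCompact h₂ h
    have hsmall : ∀ᶠ n : ℕ in atTop, ((n + 1 : ℝ≥0)⁻¹) < r := by
      have := tendsto_one_div_add_atTop_nhds_zero_nat (𝕜 := ℝ≥0)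
      simp only [one_div] at this
      exact this.eventually_lt_const hr
    refine Filter.Eventually.filter_mono Nat.hyperfilter_le_atTop ?_
    filter_upwards [hsmall] with n hn
    exact packingRatio_add_le fun a ha b hb =>
      (ENNReal.coe_lt_coe.2 hn).trans (hrd a ha b hb)

theorem packingContent_top [Nonempty X] : packingContent X ⊤ = 1 := by
  have h : packingLimit (Set.univ : Set X) = 1 := by
    refine tendsto_nhds_unique (tendsto_packingLimit _) ?_
    simp only [packingRatio_univ]
    exact tendsto_const_nhds
  change ((packingLimit (Set.univ : Set X) : ℝ≥0) : ℝ≥0∞) = 1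
  rw [h, ENNReal.coe_one]

theorem packingContent_le_of_edist_eq {K L : Compacts X} {f : X → X} (hfK : f '' K = L)
    (hf : ∀ x ∈ K, ∀ y ∈ K, edist (f x) (f y) = edist x y) :
    packingContent X K ≤ packingContent X L := by
  refine ENNReal.coe_le_coe.2 (le_of_tendsto_of_tendsto' (tendsto_packingLimit _)
    (tendsto_packingLimit _) fun n => ?_)
  rw [← hfK]
  exact packingRatio_le_packingRatio_image n hf

/-- An open `U ⊇ A` yields the open set `e '' (e.source ∩ U) ⊇ e '' A`, and each compact subset of
the latter is pulled back by `e.symm` to a compact subset of `U` of no smaller content. -/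
theorem packingContent_outerMeasure_image_le {e : PartialEquiv X X} (he : IsPartialIsometry e)
    {A : Set X} (hA : A ⊆ e.source) :
    (packingContent X).outerMeasure (e '' A) ≤ (packingContent X).outerMeasure A := by
  rw [Content.outerMeasure_eq_iInf _ A]
  refine le_iInf₂ fun U hU => le_iInf fun hAU => ?_
  have himage : e '' (e.source ∩ U) = e.target ∩ e.symm ⁻¹' U := e.image_source_inter_eq' U
  have hV : IsOpen (e '' (e.source ∩ U)) := by
    rw [himage]
    exact he.symm.continuousOn.isOpen_inter_preimage he.isOpen_target hU
  refine (measure_mono (Set.image_mono (Set.subset_inter hA hAU))).trans ?_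
  rw [Content.outerMeasure_of_isOpen _ _ hV]
  refine iSup₂_le fun K hK => ?_
  have hKV : (K : Set X) ⊆ e.target ∩ e.symm ⁻¹' U := himage ▸ hK
  have hKt : (K : Set X) ⊆ e.target := hKV.trans Set.inter_subset_left
  let L : Compacts X :=
    ⟨e.symm '' K, K.isCompact.image_of_continuousOn (he.symm.continuousOn.mono hKt)⟩
  calc packingContent X K ≤ packingContent X L :=
        packingContent_le_of_edist_eq rfl fun x hx y hy =>
          he.symm.edist_eq x (hKt hx) y (hKt hy)
    _ ≤ _ := Content.le_innerContent _ L ⟨U, hU⟩ (by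
        rintro _ ⟨x, hx, rfl⟩
        exact (hKV hx).2)

theorem packingContent_outerMeasure_image {e : PartialEquiv X X} (he : IsPartialIsometry e)
    {A : Set X} (hA : A ⊆ e.source) :
    (packingContent X).outerMeasure (e '' A) = (packingContent X).outerMeasure A := by
  refine le_antisymm (packingContent_outerMeasure_image_le he hA) ?_
  have h := packingContent_outerMeasure_image_le he.symm (A := e '' A)
    (e.mapsTo.mono_left hA).image_subset
  rwa [e.symm_image_image_of_subset_source hA] at h

/-- On a compact metric space there is a Borel probability measure that is invariant under all
isometries between open subsets. -/
theorem exists_isProbabilityMeasure_image_eq [MeasurableSpace X] [BorelSpace X] [Nonempty X] :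
    ∃ μ : Measure X, IsProbabilityMeasure μ ∧
      ∀ e : PartialEquiv X X, IsPartialIsometry e → ∀ A ⊆ e.source, μ (e '' A) = μ A := by
  -- By outer regularity this holds for nonmeasurable sets too, so invariance is obtained for
  -- arbitrary subsets; non-Borel `G` will need that.
  have happly : ∀ A : Set X, (packingContent X).measure A = (packingContent X).outerMeasure A := by
    refine fun A => le_antisymm ?_ (le_toMeasure_apply _ _ _)
    rw [Content.outerMeasure_eq_iInf _ A]
    refine le_iInf₂ fun U hU => le_iInf fun hAU => (measure_mono hAU).trans ?_
    rw [Content.measure_apply _ hU.measurableSet, Content.outerMeasure_of_isOpen _ _ hU]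
  refine ⟨(packingContent X).measure, ⟨?_⟩, fun e he A hA => ?_⟩
  · rw [happly, Content.outerMeasure_of_isOpen _ _ isOpen_univ,
      Content.innerContent_of_isCompact _ isCompact_univ isOpen_univ]
    exact packingContent_top
  · rw [happly, happly, packingContent_outerMeasure_image he hA]

end PackingContent

/-! ### Conjugation, adjoints and continuity in Cayley–Dickson algebras -/

namespace CayleyDickson

/-- The Euclidean pairing in coordinates. -/
noncomputable def dotFun (v : ℕ) (x y : CDIndex v → ℝ) : ℝ := ∑ i, x i * y i

theorem dotFun_succ {v : ℕ} (x y : CDIndex (v + 1) → ℝ) :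
    dotFun (v + 1) x y = dotFun v (fun i => x (Sum.inl i)) (fun i => y (Sum.inl i)) +
      dotFun v (fun i => x (Sum.inr i)) (fun i => y (Sum.inr i)) :=
  Fintype.sum_sum_type (α₁ := CDIndex v) (α₂ := CDIndex v) fun i => x i * y i

theorem dotFun_add_left {v : ℕ} (x y z : CDIndex v → ℝ) :
    dotFun v (x + y) z = dotFun v x z + dotFun v y z := add_dotProduct x y z

theorem dotFun_sub_left {v : ℕ} (x y z : CDIndex v → ℝ) :
    dotFun v (x - y) z = dotFun v x z - dotFun v y z := sub_dotProduct x y z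

theorem dotFun_sub_right {v : ℕ} (x y z : CDIndex v → ℝ) :
    dotFun v x (y - z) = dotFun v x y - dotFun v x z := dotProduct_sub x y z

theorem dotFun_add_right {v : ℕ} (x y z : CDIndex v → ℝ) :
    dotFun v x (y + z) = dotFun v x y + dotFun v x z := dotProduct_add x y z

theorem dotFun_neg_right {v : ℕ} (x y : CDIndex v → ℝ) :
    dotFun v x (-y) = -dotFun v x y := dotProduct_neg x y

theorem dotFun_neg_left {v : ℕ} (x y : CDIndex v → ℝ) :
    dotFun v (-x) y = -dotFun v x y := neg_dotProduct x y

/-- The element `a + b l` in coordinates. -/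
def pairFun {v : ℕ} (a b : CDIndex v → ℝ) : CDIndex (v + 1) → ℝ := Sum.elim a b

theorem exists_pairFun {v : ℕ} (x : CDIndex (v + 1) → ℝ) : ∃ a b, x = pairFun a b :=
  ⟨fun i => x (Sum.inl i), fun i => x (Sum.inr i), (Sum.elim_comp_inl_inr x).symm⟩

theorem dotFun_pair {v : ℕ} (a b c d : CDIndex v → ℝ) :
    dotFun (v + 1) (pairFun a b) (pairFun c d) = dotFun v a c + dotFun v b d := dotFun_succ _ _

theorem conjFun_pair {v : ℕ} (a b : CDIndex v → ℝ) :
    conjFun (v + 1) (pairFun a b) = pairFun (conjFun v a) (-b) := rfl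

theorem mulFun_pair {v : ℕ} (a b c d : CDIndex v → ℝ) :
    mulFun (v + 1) (pairFun a b) (pairFun c d) =
      pairFun (mulFun v a c - mulFun v (conjFun v d) b)
        (mulFun v d a + mulFun v b (conjFun v c)) := rfl

theorem conjFun_conjFun {v : ℕ} (x : CDIndex v → ℝ) : conjFun v (conjFun v x) = x := by
  induction v with
  | zero => rfl
  | succ v ih =>
    obtain ⟨a, b, rfl⟩ := exists_pairFun x
    rw [conjFun_pair, conjFun_pair, ih, neg_neg]

theorem pairFun_add {v : ℕ} (a b c d : CDIndex v → ℝ) :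
    pairFun a b + pairFun c d = pairFun (a + c) (b + d) := Sum.elim_add_add _ _ _ _ |>.symm

theorem conjFun_add {v : ℕ} (x y : CDIndex v → ℝ) :
    conjFun v (x + y) = conjFun v x + conjFun v y := by
  induction v with
  | zero => rfl
  | succ v ih =>
    obtain ⟨a, b, rfl⟩ := exists_pairFun x
    obtain ⟨c, d, rfl⟩ := exists_pairFun y
    rw [pairFun_add, conjFun_pair, conjFun_pair, conjFun_pair, pairFun_add, ih, neg_add]

theorem pairFun_neg {v : ℕ} (a b : CDIndex v → ℝ) : -pairFun a b = pairFun (-a) (-b) :=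
  (Sum.elim_neg_neg a b).symm

theorem conjFun_neg {v : ℕ} (x : CDIndex v → ℝ) : conjFun v (-x) = -conjFun v x := by
  induction v with
  | zero => rfl
  | succ v ih =>
    obtain ⟨a, b, rfl⟩ := exists_pairFun x
    rw [pairFun_neg, conjFun_pair, conjFun_pair, pairFun_neg, ih]

/-- Both signs are treated in one induction because the doubling rule puts components of the right
factor on the left. -/
theorem mulFun_neg_left_and_right {v : ℕ} (x y : CDIndex v → ℝ) :
    mulFun v (-x) y = -mulFun v x y ∧ mulFun v x (-y) = -mulFun v x y := by
  induction v with
  | zero => exact ⟨funext fun i => neg_mul _ _, funext fun i => mul_neg _ _⟩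
  | succ v ih =>
    obtain ⟨a, b, rfl⟩ := exists_pairFun x
    obtain ⟨c, d, rfl⟩ := exists_pairFun y
    simp only [pairFun_neg, mulFun_pair, conjFun_neg, (ih _ _).1, (ih _ _).2]
    constructor <;> congr 1 <;> abel

theorem conjFun_mulFun {v : ℕ} (x y : CDIndex v → ℝ) :
    conjFun v (mulFun v x y) = mulFun v (conjFun v y) (conjFun v x) := by
  induction v with
  | zero => exact funext fun i => mul_comm _ _
  | succ v ih =>
    obtain ⟨a, b, rfl⟩ := exists_pairFun x
    obtain ⟨c, d, rfl⟩ := exists_pairFun y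
    simp only [conjFun_pair, mulFun_pair, conjFun_conjFun, conjFun_neg, sub_eq_add_neg,
      conjFun_add, ih, (mulFun_neg_left_and_right _ _).1, (mulFun_neg_left_and_right _ _).2]
    congr 1
    · abel
    · abel

theorem dotFun_conjFun {v : ℕ} (x y : CDIndex v → ℝ) :
    dotFun v (conjFun v x) (conjFun v y) = dotFun v x y := by
  induction v with
  | zero => rfl
  | succ v ih =>
    obtain ⟨a, b, rfl⟩ := exists_pairFun x
    obtain ⟨c, d, rfl⟩ := exists_pairFun y
    simp only [conjFun_pair, dotFun_pair, ih, dotFun_neg_left, dotFun_neg_right, neg_neg]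

/-- Multiplication by the conjugate is adjoint to multiplication, on both sides. -/
theorem dotFun_mulFun {v : ℕ} (x y z : CDIndex v → ℝ) :
    dotFun v (mulFun v x y) z = dotFun v x (mulFun v z (conjFun v y)) ∧
      dotFun v (mulFun v x y) z = dotFun v y (mulFun v (conjFun v x) z) := by
  induction v with
  | zero =>
    constructor <;> refine Finset.sum_congr rfl fun i _ => ?_ <;>
      simp only [mulFun, conjFun] <;> ring
  | succ v ih =>
    obtain ⟨a, b, rfl⟩ := exists_pairFun x
    obtain ⟨c, d, rfl⟩ := exists_pairFun y
    obtain ⟨p, q, rfl⟩ := exists_pairFun z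
    simp only [conjFun_pair, mulFun_pair, dotFun_pair, dotFun_sub_left, dotFun_add_left,
      dotFun_sub_right, dotFun_add_right, conjFun_conjFun, conjFun_neg,
      (mulFun_neg_left_and_right _ _).1, (mulFun_neg_left_and_right _ _).2, dotFun_neg_right]
    -- Since doubling exchanges left and right factors, each adjunction uses both adjunctions one
    -- level below. `h9` and `h10` remove the conjugates from `d` and `c` by invariance of the
    -- pairing.
    have h1 := (ih a c p).1
    have h2 := (ih a c p).2
    have h3 := (ih (conjFun v d) b p).2
    have h4 := (ih (conjFun v d) b p).1
    have h5 := (ih d a q).2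
    have h6 := (ih d a q).1
    have h7 := (ih b (conjFun v c) q).1
    have h8 := (ih b (conjFun v c) q).2
    rw [conjFun_conjFun] at h3 h7
    have h9 : dotFun v (conjFun v d) (mulFun v p (conjFun v b)) =
        dotFun v d (mulFun v b (conjFun v p)) := by
      rw [← dotFun_conjFun, conjFun_conjFun, conjFun_mulFun, conjFun_conjFun]
    have h10 : dotFun v (conjFun v c) (mulFun v (conjFun v b) q) =
        dotFun v c (mulFun v (conjFun v q) b) := by
      rw [← dotFun_conjFun, conjFun_conjFun, conjFun_mulFun, conjFun_conjFun]
    constructor <;> linarith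

theorem continuous_conjFun (v : ℕ) : Continuous (conjFun v) := by
  induction v with
  | zero => exact continuous_id
  | succ v ih =>
    refine continuous_pi fun i => ?_
    rcases i with i | i
    · exact (continuous_apply i).comp (ih.comp (continuous_pi fun j => continuous_apply _))
    · exact (continuous_apply (Sum.inr i)).neg

theorem continuous_mulFun (v : ℕ) :
    Continuous fun p : (CDIndex v → ℝ) × (CDIndex v → ℝ) => mulFun v p.1 p.2 := by
  induction v with
  | zero => exact continuous_fst.mul continuous_snd
  | succ v ih =>
    have hfst (s : CDIndex v → CDIndex (v + 1)) : Continuous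
        fun p : (CDIndex (v + 1) → ℝ) × (CDIndex (v + 1) → ℝ) => fun i => p.1 (s i) :=
      continuous_pi fun i => (continuous_apply _).comp continuous_fst
    have hsnd (s : CDIndex v → CDIndex (v + 1)) : Continuous
        fun p : (CDIndex (v + 1) → ℝ) × (CDIndex (v + 1) → ℝ) => fun i => p.2 (s i) :=
      continuous_pi fun i => (continuous_apply _).comp continuous_snd
    have hconj (s : CDIndex v → CDIndex (v + 1)) := (continuous_conjFun v).comp (hsnd s)
    refine continuous_pi fun i => ?_
    rcases i with i | i
    · exact (continuous_apply i).comp ((ih.comp ((hfst Sum.inl).prodMk (hsnd Sum.inl))).sub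
        (ih.comp ((hconj Sum.inr).prodMk (hfst Sum.inr))))
    · exact (continuous_apply i).comp ((ih.comp ((hsnd Sum.inr).prodMk (hfst Sum.inl))).add
        (ih.comp ((hfst Sum.inr).prodMk (hconj Sum.inl))))

variable {v : ℕ}

theorem continuous_conj : Continuous (conj : CayleyDickson v → CayleyDickson v) :=
  (PiLp.continuous_toLp 2 _).comp ((continuous_conjFun v).comp (PiLp.continuous_ofLp 2 _))

theorem continuous_mul :
    Continuous fun p : CayleyDickson v × CayleyDickson v => mul p.1 p.2 :=
  (PiLp.continuous_toLp 2 _).comp ((continuous_mulFun v).comp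
    (((PiLp.continuous_ofLp 2 _).comp continuous_fst).prodMk
      ((PiLp.continuous_ofLp 2 _).comp continuous_snd)))

theorem inner_eq_dotFun (x y : CayleyDickson v) : inner ℝ x y = dotFun v x.ofLp y.ofLp := by
  simp [PiLp.inner_apply, dotFun, mul_comm]

theorem inner_mul (x y z : CayleyDickson v) :
    inner ℝ (mul x y) z = inner ℝ x (mul z (conj y)) := by
  simp only [inner_eq_dotFun]
  exact (dotFun_mulFun _ _ _).1

theorem conj_conj (x : CayleyDickson v) : conj (conj x) = x :=
  congrArg (WithLp.toLp 2) (conjFun_conjFun x.ofLp)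

theorem norm_conj (x : CayleyDickson v) : ‖conj x‖ = ‖x‖ := by
  rw [@norm_eq_sqrt_real_inner _ _ _ (conj x), @norm_eq_sqrt_real_inner _ _ _ x, inner_eq_dotFun,
    inner_eq_dotFun]
  exact congrArg Real.sqrt (dotFun_conjFun _ _)

theorem norm_inv (x : CayleyDickson v) : ‖inv x‖ = ‖x‖⁻¹ := by
  rw [inv, norm_smul, norm_conj, Real.norm_of_nonneg (by positivity)]
  rcases eq_or_ne ‖x‖ 0 with h | h
  · simp [h]
  · field_simp

theorem inv_eq_conj {x : CayleyDickson v} (hx : ‖x‖ = 1) : inv x = conj x := by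
  simp [inv, hx]

/-! ### Right translations in subgroups of the unit ball -/

section Subgroup

variable {G : Set (CayleyDickson v)}

/-- A subgroup of the unit ball is contained in the unit sphere. -/
theorem IsSubgroup.norm_eq_one (hG : IsSubgroup G) (hGB : G ⊆ unitBall v) {g : CayleyDickson v}
    (hg : g ∈ G) : ‖g‖ = 1 := by
  have h1 := (hGB hg).2
  have h2 := (hGB (hG.inv_mem g hg)).2
  have hpos : 0 < ‖g‖ := norm_pos_iff.2 (hGB hg).1
  rw [norm_inv] at h2
  exact le_antisymm h1 (by simpa using (inv_le_comm₀ hpos one_pos).1 h2)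

theorem IsSubgroup.conj_mem (hG : IsSubgroup G) (hGB : G ⊆ unitBall v) {g : CayleyDickson v}
    (hg : g ∈ G) : conj g ∈ G :=
  inv_eq_conj (hG.norm_eq_one hGB hg) ▸ hG.inv_mem g hg

/-- The right inverse property holds in a subgroup of the unit ball, in spite of the lack of
alternativity, because of the case of equality in the Cauchy–Schwarz inequality. -/
theorem IsSubgroup.mul_mul_conj (hG : IsSubgroup G) (hGB : G ⊆ unitBall v)
    {x g : CayleyDickson v} (hx : x ∈ G) (hg : g ∈ G) (hxg : mul x g ≠ 0) :
    mul (mul x g) (conj g) = x := by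
  have hinner : inner ℝ (mul (mul x g) (conj g)) x = 1 := by
    rw [inner_mul, conj_conj, real_inner_self_eq_norm_sq,
      hG.norm_eq_one hGB (hG.mul_mem x hx g hg hxg), one_pow]
  -- Nonvanishing puts the product back in `G`, hence on the unit sphere, as the equality case of
  -- Cauchy–Schwarz requires.
  have hne : mul (mul x g) (conj g) ≠ 0 := fun h => by simp [h] at hinner
  have hmem := hG.mul_mem _ (hG.mul_mem x hx g hg hxg) _ (hG.conj_mem hGB hg) hne
  exact (inner_eq_one_iff_of_norm_eq_one (hG.norm_eq_one hGB hmem)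
    (hG.norm_eq_one hGB hx)).1 hinner

theorem IsSubgroup.inner_mul_mul (hG : IsSubgroup G) (hGB : G ⊆ unitBall v)
    {x g : CayleyDickson v} (hx : x ∈ G) (hg : g ∈ G) (hxg : mul x g ≠ 0) (y : CayleyDickson v) :
    inner ℝ (mul y g) (mul x g) = inner ℝ y x := by
  rw [inner_mul, hG.mul_mul_conj hGB hx hg hxg]

theorem IsSubgroup.dist_mul_mul (hG : IsSubgroup G) (hGB : G ⊆ unitBall v)
    {x y g : CayleyDickson v} (hx : x ∈ G) (hy : y ∈ G) (hg : g ∈ G) (hxg : mul x g ≠ 0)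
    (hyg : mul y g ≠ 0) : dist (mul x g) (mul y g) = dist x y := by
  rw [dist_eq_norm, dist_eq_norm, ← sq_eq_sq₀ (norm_nonneg _) (norm_nonneg _),
    norm_sub_sq_real, norm_sub_sq_real, hG.inner_mul_mul hGB hy hg hyg,
    hG.norm_eq_one hGB hx, hG.norm_eq_one hGB hy,
    hG.norm_eq_one hGB (hG.mul_mem x hx g hg hxg), hG.norm_eq_one hGB (hG.mul_mem y hy g hg hyg)]

theorem IsSubgroup.closure_norm_eq_one (hG : IsSubgroup G) (hGB : G ⊆ unitBall v)
    {g : CayleyDickson v} (hg : g ∈ closure G) : ‖g‖ = 1 := by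
  have hsub : closure G ⊆ {z : CayleyDickson v | ‖z‖ = 1} :=
    closure_minimal (fun z hz => hG.norm_eq_one hGB hz)
      (isClosed_eq continuous_norm continuous_const)
  exact hsub hg

theorem IsSubgroup.closure_subset_unitBall (hG : IsSubgroup G) (hGB : G ⊆ unitBall v) :
    closure G ⊆ unitBall v := fun g hg => by
  have h := hG.closure_norm_eq_one hGB hg
  exact ⟨norm_pos_iff.1 (h ▸ one_pos), h.le⟩

/-- Having a nonzero product is an open condition on pairs, so such a pair in the closure is a limit
of pairs from `G` with nonzero product, to which closedness under multiplication applies. -/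
theorem IsSubgroup.isSubgroup_closure (hG : IsSubgroup G) (hGB : G ⊆ unitBall v) :
    IsSubgroup (closure G) where
  zero_notMem h := (hG.closure_subset_unitBall hGB h).1 rfl
  one_mem := subset_closure hG.one_mem
  inv_mem g hg := by
    rw [inv_eq_conj (hG.closure_norm_eq_one hGB hg)]
    exact map_mem_closure continuous_conj hg fun x hx => hG.conj_mem hGB hx
  mul_mem g hg h hh hgh := by
    have hopen : IsOpen {p : CayleyDickson v × CayleyDickson v | mul p.1 p.2 ≠ 0} :=
      isOpen_ne_fun continuous_mul continuous_const
    have hmem : (g, h) ∈ closure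
        ({p : CayleyDickson v × CayleyDickson v | mul p.1 p.2 ≠ 0} ∩ G ×ˢ G) :=
      hopen.inter_closure ⟨hgh, by rw [closure_prod_eq]; exact ⟨hg, hh⟩⟩
    exact map_mem_closure (f := fun p : CayleyDickson v × CayleyDickson v => mul p.1 p.2)
      continuous_mul hmem fun p hp => hG.mul_mem p.1 hp.2.1 p.2 hp.2.2 hp.1

open Classical in
/-- The right translation of a subgroup by an element, with the junk value `h` if `h g = 0`. -/
noncomputable def IsSubgroup.translate (hG : IsSubgroup G) (g h : G) : G :=
  if hgh : mul (h : CayleyDickson v) g ≠ 0 then ⟨mul h g, hG.mul_mem h h.2 g g.2 hgh⟩ else h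

theorem IsSubgroup.coe_translate (hG : IsSubgroup G) {g h : G}
    (hgh : mul (h : CayleyDickson v) g ≠ 0) : (hG.translate g h : CayleyDickson v) = mul h g := by
  rw [translate, dif_pos hgh]

theorem IsSubgroup.mul_mul_conj_ne_zero (hG : IsSubgroup G) (hGB : G ⊆ unitBall v)
    {x g : CayleyDickson v} (hx : x ∈ G) (hg : g ∈ G) (hxg : mul x g ≠ 0) :
    mul (mul x g) (conj g) ≠ 0 := by
  rw [hG.mul_mul_conj hGB hx hg hxg]
  exact (hGB hx).1

/-- Right translation by `g` as a partial bijection of `G`, whose inverse is right translation by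
the conjugate of `g`. -/
noncomputable def IsSubgroup.translateEquiv (hG : IsSubgroup G) (hGB : G ⊆ unitBall v) (g : G) :
    PartialEquiv G G where
  toFun := hG.translate g
  invFun := hG.translate ⟨conj (g : CayleyDickson v), hG.conj_mem hGB g.2⟩
  source := {h | mul (h : CayleyDickson v) g ≠ 0}
  target := {h | mul (h : CayleyDickson v) (conj (g : CayleyDickson v)) ≠ 0}
  map_source' h hh := by
    rw [Set.mem_ofPred_eq, hG.coe_translate hh]
    exact hG.mul_mul_conj_ne_zero hGB h.2 g.2 hh
  map_target' h hh := by
    rw [Set.mem_ofPred_eq, hG.coe_translate (g := ⟨_, hG.conj_mem hGB g.2⟩) hh]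
    simpa only [conj_conj] using hG.mul_mul_conj_ne_zero hGB h.2 (hG.conj_mem hGB g.2) hh
  left_inv' h hh := by
    have h1 : mul (hG.translate g h : CayleyDickson v) (conj (g : CayleyDickson v)) = h := by
      rw [hG.coe_translate hh, hG.mul_mul_conj hGB h.2 g.2 hh]
    exact Subtype.ext ((hG.coe_translate (g := ⟨_, hG.conj_mem hGB g.2⟩)
      (h1 ▸ (hGB h.2).1)).trans h1)
  right_inv' h hh := by
    have h1 : mul (hG.translate ⟨_, hG.conj_mem hGB g.2⟩ h : CayleyDickson v) g = h := by
      have h2 := hG.mul_mul_conj hGB h.2 (hG.conj_mem hGB g.2) hh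
      rw [conj_conj] at h2
      rw [hG.coe_translate (g := ⟨_, hG.conj_mem hGB g.2⟩) hh, h2]
    exact Subtype.ext ((hG.coe_translate (h1 ▸ (hGB h.2).1)).trans h1)

theorem isOpen_setOf_mul_ne_zero (g : CayleyDickson v) :
    IsOpen {h : G | mul (h : CayleyDickson v) g ≠ 0} :=
  isOpen_ne_fun (continuous_mul.comp (continuous_subtype_val.prodMk continuous_const))
    continuous_const

theorem IsSubgroup.isPartialIsometry_translateEquiv (hG : IsSubgroup G) (hGB : G ⊆ unitBall v)
    (g : G) : IsPartialIsometry (hG.translateEquiv hGB g) where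
  isOpen_source := isOpen_setOf_mul_ne_zero _
  isOpen_target := isOpen_setOf_mul_ne_zero _
  edist_eq x hx y hy := by
    rw [edist_dist, edist_dist, Subtype.dist_eq, Subtype.dist_eq]
    change ENNReal.ofReal (dist (hG.translate g x : CayleyDickson v) (hG.translate g y)) = _
    rw [hG.coe_translate hx, hG.coe_translate hy, hG.dist_mul_mul hGB x.2 y.2 g.2 hx hy]

theorem IsSubgroup.rightTranslate_eq_image (hG : IsSubgroup G) (hGB : G ⊆ unitBall v) (A : Set G)
    (g : G) : rightTranslate A g =
      hG.translateEquiv hGB g '' {h | h ∈ A ∧ mul (h : CayleyDickson v) g ≠ 0} := by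
  ext k
  constructor
  · rintro ⟨h, hA, hk⟩
    have hne : mul (h : CayleyDickson v) g ≠ 0 := hk ▸ (hGB k.2).1
    exact ⟨h, ⟨hA, hne⟩, Subtype.ext ((hG.coe_translate hne).trans hk.symm)⟩
  · rintro ⟨h, ⟨hA, hne⟩, rfl⟩
    exact ⟨h, hA, hG.coe_translate hne⟩

/-- The translate is the preimage of `A` under the inverse translation, which is continuous on its
open domain. Hence `G` itself need not be Borel. -/
theorem IsSubgroup.measurableSet_rightTranslate (hG : IsSubgroup G) (hGB : G ⊆ unitBall v)
    {A : Set G} (hA : MeasurableSet A) (g : G) : MeasurableSet (rightTranslate A g) := by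
  have he := (hG.isPartialIsometry_translateEquiv hGB g)
  have heq : {h | h ∈ A ∧ mul (h : CayleyDickson v) g ≠ 0} =
      (hG.translateEquiv hGB g).source ∩ A := Set.inter_comm _ _
  rw [hG.rightTranslate_eq_image hGB, heq, PartialEquiv.image_source_inter_eq']
  have hmeas := (continuousOn_iff_continuous_domRestrict.1 he.symm.continuousOn).measurable hA
  convert he.isOpen_target.measurableSet.subtype_image hmeas using 1
  exact (Subtype.image_preimage_coe _ _).symm

/-- A closed subgroup of the unit ball carries a right-invariant probability measure; the
invariance holds for all sets, measurable or not. -/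
theorem IsSubgroup.exists_isProbabilityMeasure_rightTranslate (hG : IsSubgroup G)
    (hGB : G ⊆ unitBall v) (hcl : IsClosed G) :
    ∃ μ : Measure G, IsProbabilityMeasure μ ∧ ∀ (g : G) (A : Set G),
      μ (rightTranslate A g) = μ {h | h ∈ A ∧ mul (h : CayleyDickson v) g ≠ 0} := by
  have : CompactSpace G := isCompact_iff_compactSpace.1 <|
    (isCompact_closedBall (0 : CayleyDickson v) 1).of_isClosed_subset hcl fun g hg =>
      mem_closedBall_zero_iff.2 (hGB hg).2
  have : Nonempty G := ⟨⟨_, hG.one_mem⟩⟩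
  obtain ⟨μ, hμ, hinv⟩ := exists_isProbabilityMeasure_image_eq (X := G)
  refine ⟨μ, hμ, fun g A => ?_⟩
  rw [hG.rightTranslate_eq_image hGB]
  exact hinv _ (hG.isPartialIsometry_translateEquiv hGB g) _ fun h hh => hh.2

end Subgroup

end CayleyDickson

namespace CayleyDickson

open scoped ENNReal unitInterval

theorem two_le_finrank {v : ℕ} (hv : 1 ≤ v) : 2 ≤ Module.finrank ℝ (CayleyDickson v) := by
  have hcard : ∀ n, Fintype.card (CDIndex n) = 2 ^ n := by
    intro n
    induction n with
    | zero => rfl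
    | succ n ih => rw [pow_succ, mul_two, ← ih]; exact Fintype.card_sum
  rw [finrank_euclideanSpace, hcard]
  exact Nat.le_self_pow (Nat.one_le_iff_ne_zero.1 hv) 2

/-! ### The radial measure `|z|⁻¹ dz` -/

section RadialMeasure

variable {E : Type*} [NormedAddCommGroup E] [NormedSpace ℝ E] [FiniteDimensional ℝ E]
  [MeasurableSpace E] [BorelSpace E] (μ : Measure E) [μ.IsAddHaarMeasure]

theorem measurableSet_punctured_closedBall (t : ℝ) : MeasurableSet {z : E | z ≠ 0 ∧ ‖z‖ ≤ t} :=
  (measurableSet_singleton (0 : E)).compl.inter (measurableSet_le measurable_norm measurable_const)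

/-- The measure `|z|⁻¹ dz` of a ball is proportional to the power `dim E - 1` of the radius. -/
theorem setLIntegral_norm_inv_punctured_closedBall (hE : 1 ≤ Module.finrank ℝ E) {t : ℝ}
    (ht : 0 < t) :
    ∫⁻ z in {z : E | z ≠ 0 ∧ ‖z‖ ≤ t}, ENNReal.ofReal ‖z‖⁻¹ ∂μ =
      ENNReal.ofReal (t ^ (Module.finrank ℝ E - 1)) *
        ∫⁻ z in {z : E | z ≠ 0 ∧ ‖z‖ ≤ 1}, ENNReal.ofReal ‖z‖⁻¹ ∂μ := by
  have hk : Measurable fun z : E => ENNReal.ofReal ‖z‖⁻¹ := by fun_prop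
  have hpre : (fun z : E => t • z) ⁻¹' {z : E | z ≠ 0 ∧ ‖z‖ ≤ t} = {z : E | z ≠ 0 ∧ ‖z‖ ≤ 1} := by
    ext z
    simp [norm_smul, abs_of_pos ht, ht.ne', ht]
  have h := setLIntegral_map (μ := μ) (measurableSet_punctured_closedBall (E := E) t) hk
    (measurable_const_smul t)
  rw [Measure.map_addHaar_smul μ ht.ne', Measure.restrict_smul, lintegral_smul_measure, hpre,
    abs_of_pos (by positivity)] at h
  simp only [norm_smul, mul_inv, Real.norm_of_nonneg ht.le,
    ENNReal.ofReal_mul (inv_nonneg.2 ht.le)] at h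
  rw [lintegral_const_mul _ hk, smul_eq_mul] at h
  have hpow : t ^ (Module.finrank ℝ E - 1) = t ^ Module.finrank ℝ E * t⁻¹ := by
    rw [pow_sub₀ t ht.ne' hE, pow_one]
  rw [hpow, ENNReal.ofReal_mul (by positivity), mul_assoc, ← h, ← mul_assoc,
    ← ENNReal.ofReal_mul (by positivity), mul_inv_cancel₀ (by positivity), ENNReal.ofReal_one,
    one_mul]

theorem setLIntegral_norm_inv_ne_top (hE : 2 ≤ Module.finrank ℝ E) :
    ∫⁻ z in {z : E | z ≠ 0 ∧ ‖z‖ ≤ 1}, ENNReal.ofReal ‖z‖⁻¹ ∂μ ≠ ∞ := by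
  have : Nontrivial E := Module.nontrivial_of_finrank_pos (R := ℝ) (by omega)
  have hint : IntegrableOn (fun z : E => ‖z‖⁻¹) (Metric.ball 0 2) μ := by
    rw [integrableOn_fun_norm_addHaar μ (f := fun r : ℝ => r⁻¹)]
    -- In polar coordinates `r⁻¹` meets the Jacobian `r ^ (n - 1)`; for `n ≥ 2` the product is a
    -- genuine power, without truncated subtraction.
    have hcont : IntegrableOn (fun y : ℝ => y ^ (Module.finrank ℝ E - 2)) (Set.Ioo 0 2) :=
      ((continuous_pow _).integrableOn_Icc (a := 0) (b := 2)).mono_set Set.Ioo_subset_Icc_self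
    refine hcont.congr_fun (fun y hy => ?_) measurableSet_Ioo
    have hsucc : Module.finrank ℝ E - 1 = Module.finrank ℝ E - 2 + 1 := by omega
    simp only [smul_eq_mul, hsucc, pow_succ, mul_assoc, mul_inv_cancel₀ hy.1.ne', mul_one]
  refine ((hint.mono_set fun z hz => ?_).lintegral_lt_top).ne
  exact mem_ball_zero_iff.2 (hz.2.trans_lt one_lt_two)

theorem setLIntegral_norm_inv_ne_zero (hE : 1 ≤ Module.finrank ℝ E) :
    ∫⁻ z in {z : E | z ≠ 0 ∧ ‖z‖ ≤ 1}, ENNReal.ofReal ‖z‖⁻¹ ∂μ ≠ 0 := by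
  have : Nontrivial E := Module.nontrivial_of_finrank_pos (R := ℝ) (by omega)
  refine ((setLIntegral_pos_iff (by fun_prop)).2 ?_).ne'
  have hsub : Metric.ball (0 : E) 1 \ {0} ⊆
      Function.support (fun z : E => ENNReal.ofReal ‖z‖⁻¹) ∩ {z : E | z ≠ 0 ∧ ‖z‖ ≤ 1} := by
    rintro z ⟨hz, hz0⟩
    have hz0 : z ≠ 0 := hz0
    refine ⟨?_, hz0, (mem_ball_zero_iff.1 hz).le⟩
    simpa using hz0
  refine lt_of_lt_of_le ?_ (measure_mono hsub)
  rw [measure_sdiff_null (measure_singleton 0)]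
  exact Metric.measure_ball_pos μ 0 one_pos

end RadialMeasure

/-! ### The ball measure and Borel retractions -/

section BallMeasure

variable {v : ℕ}

theorem ballMeasure_apply {s : Set (unitBall v)} (hs : MeasurableSet s) :
    ballMeasure v s = ∫⁻ z in Subtype.val '' s, ENNReal.ofReal ‖z‖⁻¹ := by
  have hemb := MeasurableEmbedding.subtype_coe (measurableSet_punctured_closedBall
    (E := CayleyDickson v) 1)
  have h := hemb.comap_apply ((volume : Measure (CayleyDickson v)).withDensity
    fun z => ENNReal.ofReal ‖z‖⁻¹) s
  rw [withDensity_apply _ (hemb.measurableSet_image.2 hs)] at h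
  exact h

theorem ballMeasure_univ :
    ballMeasure v Set.univ = ∫⁻ z in {z : CayleyDickson v | z ≠ 0 ∧ ‖z‖ ≤ 1},
      ENNReal.ofReal ‖z‖⁻¹ := by
  rw [ballMeasure_apply MeasurableSet.univ, Set.image_univ, Subtype.range_coe]
  rfl

theorem isFiniteMeasure_ballMeasure (hv : 1 ≤ v) : IsFiniteMeasure (ballMeasure v) := by
  refine ⟨?_⟩
  rw [ballMeasure_univ]
  exact (setLIntegral_norm_inv_ne_top _ (two_le_finrank hv)).lt_top

/-- A power of the radius that is uniformly distributed under the ball measure. -/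
noncomputable def radialCoordinate (v : ℕ) (z : unitBall v) : I :=
  ⟨‖(z : CayleyDickson v)‖ ^ (Module.finrank ℝ (CayleyDickson v) - 1),
    by positivity, pow_le_one₀ (norm_nonneg _) z.2.2⟩

theorem measurable_radialCoordinate : Measurable (radialCoordinate v) := by
  refine Measurable.subtype_mk ?_
  fun_prop

/-- By scaling, the punctured ball of radius `t` has the fraction `t ^ (n - 1)` of the total mass.
This gives the distribution function, which determines a finite measure. -/
theorem map_radialCoordinate (hv : 1 ≤ v) :
    (ballMeasure v).map (radialCoordinate v) = ballMeasure v Set.univ • (volume : Measure I) := by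
  have hE := two_le_finrank hv
  have := isFiniteMeasure_ballMeasure hv
  have hn : Module.finrank ℝ (CayleyDickson v) - 1 ≠ 0 := by omega
  refine Measure.ext_of_Iic _ _ fun x => ?_
  rw [Measure.map_apply measurable_radialCoordinate measurableSet_Iic, Measure.smul_apply,
    unitInterval.volume_Iic, ballMeasure_apply (measurable_radialCoordinate measurableSet_Iic)]
  have hx0 : (0 : ℝ) ≤ x := x.2.1
  obtain ⟨t, ht0, htx⟩ : ∃ t : ℝ, 0 ≤ t ∧ t ^ (Module.finrank ℝ (CayleyDickson v) - 1) = x :=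
    ⟨_, by positivity, Real.rpow_inv_natCast_pow hx0 hn⟩
  have ht1 : t ≤ 1 := (pow_le_one_iff_of_nonneg ht0 hn).1 (htx ▸ x.2.2)
  have hset : Subtype.val '' (radialCoordinate v ⁻¹' Set.Iic x) =
      {z : CayleyDickson v | z ≠ 0 ∧ ‖z‖ ≤ t} := by
    ext z
    constructor
    · rintro ⟨z, hz, rfl⟩
      have hz : ‖(z : CayleyDickson v)‖ ^ (Module.finrank ℝ (CayleyDickson v) - 1) ≤ x := hz
      exact ⟨z.2.1, (pow_le_pow_iff_left₀ (norm_nonneg _) ht0 hn).1 (htx ▸ hz)⟩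
    · rintro ⟨hz0, hz⟩
      refine ⟨⟨z, hz0, hz.trans ht1⟩, ?_, rfl⟩
      change ‖z‖ ^ (Module.finrank ℝ (CayleyDickson v) - 1) ≤ x
      exact htx ▸ pow_le_pow_left₀ (norm_nonneg _) hz _
  rw [hset, ballMeasure_univ, smul_eq_mul, mul_comm, ← htx]
  -- The scaling formula needs a positive radius; at radius 0 the punctured ball is empty and the
  -- power vanishes because `n ≥ 2`.
  rcases ht0.eq_or_lt with rfl | ht
  · have hempty : {z : CayleyDickson v | z ≠ 0 ∧ ‖z‖ ≤ 0} = ∅ := by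
      ext z
      simp +contextual
    rw [hempty, zero_pow hn]
    simp
  · exact setLIntegral_norm_inv_punctured_closedBall _ (by omega) ht

/-- Every probability measure on a closed set of unit vectors is, up to normalization, the
push-forward of the ball measure under a Borel retraction. -/
theorem exists_retraction_map_eq (hv : 1 ≤ v) {G : Set (CayleyDickson v)} (hGB : G ⊆ unitBall v)
    (hG : ∀ g ∈ G, ‖g‖ = 1) (hcl : IsClosed G) (μ : Measure G) [IsProbabilityMeasure μ] :
    ∃ f : unitBall v → G, Measurable f ∧ (∀ g : G, f ⟨g, hGB g.2⟩ = g) ∧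
      (ballMeasure v).map f = ballMeasure v Set.univ • μ := by
  classical
  have : Nonempty G := μ.nonempty_of_neZero
  have := hcl.measurableSet.standardBorel
  have : Nontrivial (CayleyDickson v) :=
    Module.nontrivial_of_finrank_pos (R := ℝ) (by have := two_le_finrank hv; omega)
  obtain ⟨u, hu, hmap⟩ := μ.exists_measurable_map_eq
  have hS : MeasurableSet {z : unitBall v | (z : CayleyDickson v) ∈ G} :=
    measurable_subtype_coe hcl.measurableSet
  have hur : Measurable (u ∘ radialCoordinate v) := hu.comp measurable_radialCoordinate
  let f : unitBall v → G := fun z =>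
    if hz : (z : CayleyDickson v) ∈ G then ⟨z, hz⟩ else u (radialCoordinate v z)
  have hf : Measurable f := by
    refine Measurable.dite (s := {z : unitBall v | (z : CayleyDickson v) ∈ G})
      (f := fun z => ⟨z, z.2⟩) (g := fun z => u (radialCoordinate v z)) ?_ ?_ hS
    · exact (measurable_subtype_coe.comp measurable_subtype_coe).subtype_mk
    · exact hur.comp measurable_subtype_coe
  -- `G` lies in the Lebesgue-null unit sphere, so forcing `f` to be the identity there leaves the
  -- push-forward unchanged.
  have hnull : ballMeasure v {z : unitBall v | (z : CayleyDickson v) ∈ G} = 0 := by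
    rw [ballMeasure_apply hS]
    refine setLIntegral_measure_zero _ _ (measure_mono_null ?_
      (Measure.addHaar_sphere volume (0 : CayleyDickson v) 1))
    rintro _ ⟨z, hz, rfl⟩
    exact mem_sphere_zero_iff_norm.2 (hG z hz)
  have hae : f =ᵐ[ballMeasure v] u ∘ radialCoordinate v := by
    filter_upwards [measure_eq_zero_iff_ae_notMem.1 hnull] with z hz
    exact dif_neg hz
  refine ⟨f, hf, fun g => dif_pos g.2, ?_⟩
  rw [Measure.map_congr hae, ← Measure.map_map hu measurable_radialCoordinate,
    map_radialCoordinate hv, Measure.map_smul, hmap]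

end BallMeasure

/-! ### Subgroups that need not be closed -/

section NonClosed

variable {v : ℕ} {G : Set (CayleyDickson v)}

theorem IsSubgroup.isRightInvariant_count (hG : IsSubgroup G) (hGB : G ⊆ unitBall v) :
    IsRightInvariant (Measure.count : Measure G) := by
  intro g A hA
  have hB : MeasurableSet {h : G | h ∈ A ∧ mul (h : CayleyDickson v) g ≠ 0} :=
    hA.inter (isOpen_setOf_mul_ne_zero _).measurableSet
  have hAg := hG.measurableSet_rightTranslate hGB hA g
  refine ⟨hAg, ?_⟩
  rw [Measure.count_apply hAg, Measure.count_apply hB, hG.rightTranslate_eq_image hGB]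
  congr 1
  exact ((hG.translateEquiv hGB g).injOn.mono fun h hh => hh.2).encard_image

/-- The trace on a subset `s` of `t` of a measure on `t`. The set `s` need not be measurable. -/
noncomputable def traceMeasure {α : Type*} [MeasurableSpace α] {s t : Set α} (hst : s ⊆ t)
    (μ : Measure t) : Measure s :=
  (OuterMeasure.comap (Set.inclusion hst) μ.toOuterMeasure).toMeasure (by
    rintro A ⟨B, hB, rfl⟩ T
    have h := measure_inter_add_sdiff (μ := μ) (Set.inclusion hst '' T)
      (measurable_subtype_coe hB : MeasurableSet (Subtype.val ⁻¹' B : Set t))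
    simp only [OuterMeasure.comap_apply, Measure.coe_toOuterMeasure]
    rw [← h, ← Set.image_inter_preimage, ← Set.image_sdiff_preimage]
    rfl)

theorem traceMeasure_apply {α : Type*} [MeasurableSpace α] {s t : Set α} (hst : s ⊆ t)
    (μ : Measure t) {A : Set s} (hA : MeasurableSet A) :
    traceMeasure hst μ A = μ (Set.inclusion hst '' A) := by
  rw [traceMeasure, toMeasure_apply _ _ hA]
  rfl

/-- The trace on a subgroup of a right-invariant measure of the closure is right-invariant. -/
theorem IsSubgroup.isRightInvariant_traceMeasure (hG : IsSubgroup G) (hGB : G ⊆ unitBall v)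
    {μ : Measure (closure G)} (hμ : ∀ (g : closure G) (A : Set (closure G)),
      μ (rightTranslate A g) = μ {h | h ∈ A ∧ mul (h : CayleyDickson v) g ≠ 0}) :
    IsRightInvariant (traceMeasure (subset_closure (s := G)) μ) := by
  intro g A hA
  have hB : MeasurableSet {h : G | h ∈ A ∧ mul (h : CayleyDickson v) g ≠ 0} :=
    hA.inter (isOpen_setOf_mul_ne_zero _).measurableSet
  have hAg := hG.measurableSet_rightTranslate hGB hA g
  refine ⟨hAg, ?_⟩
  rw [traceMeasure_apply _ _ hAg, traceMeasure_apply _ _ hB]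
  -- The image of `A` in the closure may be nonmeasurable, hence the hypothesis on arbitrary sets.
  -- Translates taken in `G` and in the closure agree because `G` contains its nonzero products.
  convert hμ (Set.inclusion subset_closure g) (Set.inclusion subset_closure '' A) using 2
  · ext k
    constructor
    · rintro ⟨k, ⟨h, hA, hk⟩, rfl⟩
      exact ⟨_, ⟨h, hA, rfl⟩, hk⟩
    · rintro ⟨_, ⟨h, hA, rfl⟩, hk⟩
      have hk : (k : CayleyDickson v) = mul (h : CayleyDickson v) g := hk
      have hne : mul (h : CayleyDickson v) g ≠ 0 :=
        hk ▸ (hG.closure_subset_unitBall hGB k.2).1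
      exact ⟨⟨k, hk ▸ hG.mul_mem h h.2 g g.2 hne⟩, ⟨h, hA, hk⟩, rfl⟩
  · ext k
    constructor
    · rintro ⟨h, ⟨hA, hne⟩, rfl⟩
      exact ⟨⟨h, hA, rfl⟩, hne⟩
    · rintro ⟨⟨h, hA, rfl⟩, hne⟩
      exact ⟨h, ⟨hA, hne⟩, rfl⟩

/-- The trace of the invariant measure of the closure is right-invariant. If it vanishes, the
subgroup is too thin for it and the counting measure is used instead. -/
theorem IsSubgroup.exists_isRightInvariant (hG : IsSubgroup G) (hGB : G ⊆ unitBall v) :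
    ∃ μ : Measure G, μ ≠ 0 ∧ IsRightInvariant μ := by
  obtain ⟨μ, -, hμ⟩ := (hG.isSubgroup_closure hGB).exists_isProbabilityMeasure_rightTranslate
    (hG.closure_subset_unitBall hGB) isClosed_closure
  by_cases h0 : traceMeasure (subset_closure (s := G)) μ = 0
  · have : Nonempty G := ⟨⟨_, hG.one_mem⟩⟩
    exact ⟨Measure.count, NeZero.ne _, hG.isRightInvariant_count hGB⟩
  · exact ⟨_, h0, hG.isRightInvariant_traceMeasure hGB hμ⟩

end NonClosed

end CayleyDickson

open CayleyDickson in
theorem theorem18 (v : ℕ) (hv : 2 ≤ v) (G : Set (CayleyDickson v))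
    (hG : CayleyDickson.IsSubgroup G) (hGB : G ⊆ CayleyDickson.unitBall v)
    (hlc : LocallyConnectedSpace G) :
    ∃ μ : MeasureTheory.Measure G,
      μ ≠ 0 ∧ CayleyDickson.IsRightInvariant μ ∧
      (IsClosed G →
        ∃ f : CayleyDickson.unitBall v → G, Measurable f ∧
          (∀ g : G, f ⟨(g : CayleyDickson v), hGB g.2⟩ = g) ∧
          μ = MeasureTheory.Measure.map f (CayleyDickson.ballMeasure v)) := by
  have hv1 : 1 ≤ v := one_le_two.trans hv
  by_cases hcl : IsClosed G
  · obtain ⟨μ, hprob, hμ⟩ := hG.exists_isProbabilityMeasure_rightTranslate hGB hcl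
    obtain ⟨f, hf, hfG, hmap⟩ :=
      exists_retraction_map_eq hv1 hGB (fun g hg => hG.norm_eq_one hGB hg) hcl μ
    -- The probability measure is rescaled to the total mass of the ball measure, so that it equals
    -- the push-forward exactly.
    refine ⟨ballMeasure v Set.univ • μ, ?_, fun g A hA => ?_, fun _ => ⟨f, hf, hfG, hmap.symm⟩⟩
    · have hne : ballMeasure v Set.univ ≠ 0 := by
        rw [ballMeasure_univ]
        exact setLIntegral_norm_inv_ne_zero _ (one_le_two.trans (two_le_finrank hv1))
      intro h
      have := congrArg (fun ν : Measure G => ν Set.univ) h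
      simp [hne] at this
    · refine ⟨hG.measurableSet_rightTranslate hGB hA g, ?_⟩
      rw [Measure.smul_apply, Measure.smul_apply, hμ]
  · obtain ⟨μ, h0, hμ⟩ := hG.exists_isRightInvariant hGB
    exact ⟨μ, h0, hμ, fun h => absurd h hcl⟩
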